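/- Let $M$ be a smooth manifold of dimension $2n+s$ ($n,s>0$) with a Riemannian metric $g$ and Levi-Civita connection $\nabla$. A \emph{weak metric $f$-structure} on $(M,g)$ consists of a skew-symmetric $(1,1)$-tensor $f$ of rank $2n$, a self-adjoint nonsingular $(1,1)$-tensor $Q$, orthonormal vector fields $\xi_1,\dots,\xi_s$ and $1$-forms $\eta^1,\dots,\eta^s$ (all smooth) such that, for all vector fields $X,Y$, $$f^2=-Q+\sum_{i=1}^s\eta^i\otimes\xi_i,\qquad \eta^i(\xi_j)=\delta^i_j,\qquad Q\xi_i=\xi_i,$$ $$g(fX,fY)=g(X,QY)-\sum_{i=1}^s\eta^i(X)\,\eta^i(Y).$$ It is a \emph{nearly $\mathcal C$-structure} if moreover $Q=\mathrm{Id}$ and $(\nabla_Xf)Y+(\nabla_Yf)X=0$ for all vector fields $X,Y$. Put $\mathcal D=\bigcap_{i=1}^s\ker\eta^i$ (the contact distribution) and $R_{X,Y}=[\nabla_X,\nabla_Y]-\nabla_{[X,Y]}$. \textbf{Statement.} For every nearly $\mathcal C$-structure the contact distribution $\mathcal D$ is curvature invariant: at every point $p\in M$ and for all smooth vector fields $X,Y,Z$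 on $M$ with $X_p,Y_p,Z_p\in\mathcal D_p$, one has $(R_{X,Y}Z)_p\in\mathcal D_p$. In particular, $R_{X,Y}Z\in\mathcal D$ for all $X,Y,Z\in\mathcal D$. -/

import Mathlib

open Bundle VectorField
open scoped Manifold ContDiff

noncomputable section

namespace FManifold

section Connection

variable {E : Type*} [NormedAddCommGroup E] [NormedSpace ℝ E]
  {H : Type*} [TopologicalSpace H] {I : ModelWithCorners ℝ E H}
  {M : Type*} [TopologicalSpace M] [ChartedSpace H M] [IsManifold I ∞ M]

/-- `X` is a smooth vector field on `M`. -/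
def IsSmoothField (X : Π x : M, TangentSpace I x) : Prop :=
  ContMDiff I (I.prod 𝓘(ℝ, E)) ∞ (fun x ↦ TotalSpace.mk' E x (X x))

/-- `α` is a smooth 1-form on `M`. -/
def IsSmoothOneForm (α : Π x : M, TangentSpace I x →L[ℝ] ℝ) : Prop :=
  ContMDiff I (I.prod 𝓘(ℝ, E →L[ℝ] ℝ)) ∞
    (fun x ↦ TotalSpace.mk' (E →L[ℝ] ℝ) (E := fun x : M ↦ TangentSpace I x →L[ℝ] ℝ) x (α x))

/-- `A` is a smooth (1,1)-tensor field on `M`. -/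
def IsSmoothEndo
    (A : Π x : M, TangentSpace I x →L[ℝ] TangentSpace I x) : Prop :=
  ContMDiff I (I.prod 𝓘(ℝ, E →L[ℝ] E)) ∞
    (fun x ↦ TotalSpace.mk' (E →L[ℝ] E)
      (E := fun x : M ↦ TangentSpace I x →L[ℝ] TangentSpace I x) x (A x))

/-- The vector field `∇_X Y` (Mathlib writes the arguments of a connection in the
order `∇ Y x (X x)`). -/
def covDeriv (cov : CovariantDerivative I E (fun x : M ↦ TangentSpace I x))
    (X Y : Π x : M, TangentSpace I x) : Π x : M, TangentSpace I x :=
  fun x ↦ cov Y x (X x)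

/-- The vector field `(∇_X A) Y = ∇_X (A Y) - A (∇_X Y)` for a (1,1)-tensor field `A`. -/
def covDerivEndo (cov : CovariantDerivative I E (fun x : M ↦ TangentSpace I x))
    (A : Π x : M, TangentSpace I x →L[ℝ] TangentSpace I x)
    (X Y : Π x : M, TangentSpace I x) : Π x : M, TangentSpace I x :=
  fun x ↦ covDeriv cov X (fun y ↦ A y (Y y)) x - A x (covDeriv cov X Y x)

/-- The curvature `R_{X,Y} Z = ∇_X ∇_Y Z - ∇_Y ∇_X Z - ∇_{[X,Y]} Z`. -/
def curvature (cov : CovariantDerivative I E (fun x : M ↦ TangentSpace I x))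
    (X Y Z : Π x : M, TangentSpace I x) : Π x : M, TangentSpace I x :=
  fun x ↦ covDeriv cov X (covDeriv cov Y Z) x - covDeriv cov Y (covDeriv cov X Z) x
    - covDeriv cov (mlieBracket I X Y) Z x

/-- `cov` is the Levi-Civita connection of the Riemannian metric of `M`: a smooth affine
connection with `X g(Y, Z) = g(∇_X Y, Z) + g(Y, ∇_X Z)` and `∇_X Y - ∇_Y X = [X, Y]`. -/
structure IsLeviCivita [RiemannianBundle (fun x : M ↦ TangentSpace I x)]
    (cov : CovariantDerivative I E (fun x : M ↦ TangentSpace I x)) : Prop where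
  smooth : cov.ContMDiffCovariantDerivative ∞
  metric : ∀ X Y Z : Π x : M, TangentSpace I x,
    IsSmoothField X → IsSmoothField Y → IsSmoothField Z → ∀ x : M,
      mvfderiv I (fun y ↦ (inner ℝ (Y y) (Z y) : ℝ)) x (X x) =
        inner ℝ (covDeriv cov X Y x) (Z x) + inner ℝ (Y x) (covDeriv cov X Z x)
  torsion_free : ∀ X Y : Π x : M, TangentSpace I x,
    IsSmoothField X → IsSmoothField Y → ∀ x : M,
      covDeriv cov X Y x - covDeriv cov Y X x = mlieBracket I X Y x

end Connection

section Structures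

variable {E : Type*} [NormedAddCommGroup E] [NormedSpace ℝ E] [FiniteDimensional ℝ E]
  {H : Type*} [TopologicalSpace H] (I : ModelWithCorners ℝ E H)
  (M : Type*) [TopologicalSpace M] [ChartedSpace H M] [IsManifold I ∞ M]
  [RiemannianBundle (fun x : M ↦ TangentSpace I x)]

/-- A weak metric `f`-structure `(f, Q, ξ, η, g)` on a manifold of dimension `2 n + s`, where `g`
is the ambient Riemannian metric of `M`. -/
structure WeakMetricFStructure (n s : ℕ) where
  f : Π x : M, TangentSpace I x →L[ℝ] TangentSpace I x
  Q : Π x : M, TangentSpace I x →L[ℝ] TangentSpace I x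
  ξ : Fin s → Π x : M, TangentSpace I x
  η : Fin s → Π x : M, TangentSpace I x →L[ℝ] ℝ
  n_pos : 0 < n
  s_pos : 0 < s
  dim_eq : Module.finrank ℝ E = 2 * n + s
  f_smooth : IsSmoothEndo f
  Q_smooth : IsSmoothEndo Q
  ξ_smooth : ∀ i, IsSmoothField (ξ i)
  η_smooth : ∀ i, IsSmoothOneForm (η i)
  f_skew : ∀ (x : M) (v w : TangentSpace I x), inner ℝ (f x v) w = - inner ℝ v (f x w)
  f_rank : ∀ x : M, Module.finrank ℝ (LinearMap.range (f x).toLinearMap) = 2 * n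
  Q_selfAdjoint : ∀ (x : M) (v w : TangentSpace I x), inner ℝ (Q x v) w = inner ℝ v (Q x w)
  Q_nonsingular : ∀ x : M, Function.Bijective (Q x)
  ξ_orthonormal : ∀ x : M, Orthonormal ℝ (fun i ↦ ξ i x)
  η_ξ : ∀ (x : M) (i j : Fin s), η i x (ξ j x) = if i = j then 1 else 0
  Q_ξ : ∀ (x : M) (i : Fin s), Q x (ξ i x) = ξ i x
  f_sq : ∀ (x : M) (v : TangentSpace I x),
    f x (f x v) = - Q x v + ∑ i, η i x v • ξ i x
  inner_f_f : ∀ (x : M) (v w : TangentSpace I x),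
    inner ℝ (f x v) (f x w) = inner ℝ v (Q x w) - ∑ i, η i x v * η i x w

namespace WeakMetricFStructure

variable {I M} {n s : ℕ}

/-- The contact distribution `D = ⋂ i, ker (η i)`. -/
def contactDistribution (S : WeakMetricFStructure I M n s) (x : M) :
    Submodule ℝ (TangentSpace I x) :=
  ⨅ i, LinearMap.ker (S.η i x).toLinearMap

/-- The structure is weak nearly `C` with respect to the connection `cov`, which is meant to be
the Levi-Civita connection: `(∇_X f) Y + (∇_Y f) X = 0`. -/
def IsWeakNearlyC (S : WeakMetricFStructure I M n s)
    (cov : CovariantDerivative I E (fun x : M ↦ TangentSpace I x)) : Prop :=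
  ∀ X Y : Π x : M, TangentSpace I x, IsSmoothField X → IsSmoothField Y →
    ∀ x : M, covDerivEndo cov S.f X Y x + covDerivEndo cov S.f Y X x = 0

/-- A nearly `C`-structure is a weak nearly `C`-structure with `Q = id`. -/
def IsNearlyC (S : WeakMetricFStructure I M n s)
    (cov : CovariantDerivative I E (fun x : M ↦ TangentSpace I x)) : Prop :=
  S.IsWeakNearlyC cov ∧ ∀ x : M, S.Q x = ContinuousLinearMap.id ℝ (TangentSpace I x)

end WeakMetricFStructure

end Structures

end FManifold

end

namespace FManifold

/-- Let `r` be skew in its first two arguments and satisfy the first Bianchi identity. If `J` acts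
on `r` as a complex structure and `r` is related to a 3-form `c` as in `rel`, then `r` vanishes. -/
theorem eq_zero_of_bianchi_of_complexStructure {V : Type*} (J : V → V) (r c : V → V → V → ℝ)
    (skew : ∀ x y z, r x y z = - r y x z)
    (bianchi : ∀ x y z, r x y z + r y z x + r z x y = 0)
    (r_J : ∀ x y z, r (J (J x)) y z = - r x y z)
    (c_swap : ∀ x y z, c x y z = - c y x z) (c_swap' : ∀ x y z, c x y z = - c x z y)
    (rel : ∀ w x y, 2 * r w x (J y) = 2 * c w x y + r (J x) y w - r (J w) y x)
    (x y z : V) : r x y z = 0 := by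
  have r_J' : ∀ x y z, r x (J (J y)) z = - r x y z := by
    intro x y z; rw [skew, r_J, skew x]
  have r_J'' : ∀ x y z, r x y (J (J z)) = - r x y z := by
    intro x y z
    linarith [bianchi x y (J (J z)), bianchi x y z, r_J' y z x, r_J z x y]
  have c_cyc : ∀ x y z, c y z x = c x y z := fun x y z ↦ by
    rw [c_swap x y z, c_swap' y x z, neg_neg]
  have rel' : ∀ x y z, 2 * r x y (J z) = 2 * c x y z + r (J y) z x + r z (J x) y := by
    intro x y z; linarith [rel x y z, skew z (J x) y]
  have key : ∀ x y z, 2 * c x y z = 2 * r x y (J z) - r (J y) z x - r z (J x) y ∧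
     2 * c x y z = 2 * r y z (J x) - r (J z) x y - r x (J y) z ∧
     2 * c x y z = 2 * r z x (J y) - r (J x) y z - r y (J z) x := fun x y z ↦ by
    refine ⟨?_, ?_, ?_⟩
    · linarith [rel' x y z]
    · linarith [rel' y z x, c_cyc x y z]
    · linarith [rel' z x y, c_cyc z x y]
  obtain ⟨k1, k2, k3⟩ := key x y z
  obtain ⟨k4, k5, k6⟩ := key (J x) y z
  obtain ⟨k7, k8, k9⟩ := key x (J y) z
  obtain ⟨k10, k11, k12⟩ := key x y (J z)
  obtain ⟨l1, l2, l3⟩ := key (J x) (J y) (J z)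
  obtain ⟨l4, l5, l6⟩ := key x (J y) (J z)
  obtain ⟨l7, l8, l9⟩ := key (J x) y (J z)
  obtain ⟨l10, l11, l12⟩ := key (J x) (J y) z
  simp only [r_J, r_J', r_J''] at k1 k2 k3 k4 k5 k6 k7 k8 k9 k10 k11 k12
  simp only [r_J, r_J', r_J''] at l1 l2 l3 l4 l5 l6 l7 l8 l9 l10 l11 l12
  linarith [bianchi x y z, bianchi (J x) y z, bianchi x (J y) z, bianchi x y (J z),
    bianchi (J x) (J y) (J z), bianchi x (J y) (J z), bianchi (J x) y (J z), bianchi (J x) (J y) z]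

section SmoothFields

variable {E : Type*} [NormedAddCommGroup E] [NormedSpace ℝ E]
  {H : Type*} [TopologicalSpace H] {I : ModelWithCorners ℝ E H}
  {M : Type*} [TopologicalSpace M] [ChartedSpace H M] [IsManifold I ∞ M]
  {X X' Y Y' Z W : Π x : M, TangentSpace I x} {u : M → ℝ}

theorem IsSmoothField.mdifferentiableAt (hX : IsSmoothField X) (x : M) : MDiffAt (T% X) x :=
  ContMDiff.mdifferentiableAt hX (by simp)

theorem IsSmoothField.sub (hX : IsSmoothField X) (hY : IsSmoothField Y) : IsSmoothField (X - Y) :=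
  ContMDiff.sub_section hX hY

theorem IsSmoothField.smul (hu : CMDiff ∞ u) (hX : IsSmoothField X) : IsSmoothField (u • X) :=
  ContMDiff.smul_section hu hX

theorem IsSmoothField.endo_apply {A : Π x : M, TangentSpace I x →L[ℝ] TangentSpace I x}
    (hA : IsSmoothEndo A) (hX : IsSmoothField X) : IsSmoothField (fun x ↦ A x (X x)) :=
  ContMDiff.clm_bundle_apply (F₁ := E) (F₂ := E) hA hX

theorem IsSmoothField.mlieBracket [CompleteSpace E]
    (hX : IsSmoothField X) (hY : IsSmoothField Y) : IsSmoothField (mlieBracket I X Y) := by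
  have : IsManifold I (minSmoothness ℝ 2) M := by
    rw [minSmoothness_of_isRCLikeNormedField]; infer_instance
  have : IsManifold I ((⊤ : ℕ∞) + 1) M := inferInstanceAs (IsManifold I ∞ M)
  exact ContDiff.mlieBracket_vectorField (m := ⊤) (n := ⊤) hX hY (by simp)

theorem mlieBracket_jacobi [CompleteSpace E]
    (hX : IsSmoothField X) (hY : IsSmoothField Y) (hZ : IsSmoothField Z) (x : M) :
    VectorField.mlieBracket I X (VectorField.mlieBracket I Y Z) x =
      VectorField.mlieBracket I (VectorField.mlieBracket I X Y) Z x
        + VectorField.mlieBracket I Y (VectorField.mlieBracket I X Z) x := by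
  have : IsManifold I (minSmoothness ℝ 3) M := by
    rw [minSmoothness_of_isRCLikeNormedField]; infer_instance
  apply leibniz_identity_mlieBracket_apply <;> rw [minSmoothness_of_isRCLikeNormedField]
  all_goals
    refine ContMDiffAt.of_le (n := ∞) ?_ (WithTop.coe_le_coe.2 (le_top : (2 : ℕ∞) ≤ ⊤))
  exacts [hX x, hY x, hZ x]

theorem contMDiff_mvfderiv_apply (hu : CMDiff ∞ u) (hX : IsSmoothField X) :
    CMDiff ∞ (fun x ↦ mvfderiv I u x (X x)) :=
  (contMDiff_snd_tangentBundle_modelSpace ℝ 𝓘(ℝ, ℝ)).comp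
    ((hu.contMDiff_tangentMap (m := ∞) (by simp)).comp hX)

/-- The derivation defined by a Lie bracket is the commutator of the derivations. -/
theorem mvfderiv_mlieBracket_apply [CompleteSpace E] (hu : CMDiff ∞ u)
    (hX : IsSmoothField X) (hY : IsSmoothField Y) (hZ : IsSmoothField Z) {x : M} (hx : Z x ≠ 0) :
    mvfderiv I u x (mlieBracket I X Y x) =
      mvfderiv I (fun y ↦ mvfderiv I u y (Y y)) x (X x)
        - mvfderiv I (fun y ↦ mvfderiv I u y (X y)) x (Y x) := by
  have hbr : ∀ {V : Π x : M, TangentSpace I x}, VectorField.mlieBracket I V (u • Z) =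
      (fun y ↦ mvfderiv I u y (V y)) • Z + u • VectorField.mlieBracket I V Z := fun {V} ↦ by
    ext y
    exact mlieBracket_smul_right (hu.mdifferentiableAt (by simp)) (hZ.mdifferentiableAt y)
  have hd : ∀ {w : M → ℝ}, CMDiff ∞ w → MDiffAt w x := fun hw ↦ hw.mdifferentiableAt (by simp)
  have expand : ∀ {V W : Π x : M, TangentSpace I x}, IsSmoothField V → IsSmoothField W →
      VectorField.mlieBracket I V (VectorField.mlieBracket I W (u • Z)) x =
        (mvfderiv I (fun y ↦ mvfderiv I u y (W y)) x (V x)) • Z x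
        + mvfderiv I u x (W x) • VectorField.mlieBracket I V Z x
        + mvfderiv I u x (V x) • VectorField.mlieBracket I W Z x
        + u x • VectorField.mlieBracket I V (VectorField.mlieBracket I W Z) x := by
    intro V W hV hW
    have hc := contMDiff_mvfderiv_apply hu hW
    rw [hbr, mlieBracket_add_right ((hZ.smul hc).mdifferentiableAt x)
      (((hW.mlieBracket hZ).smul hu).mdifferentiableAt x),
      mlieBracket_smul_right (hd hc) (hZ.mdifferentiableAt x),
      mlieBracket_smul_right (hd hu) ((hW.mlieBracket hZ).mdifferentiableAt x)]
    module
  have h := mlieBracket_jacobi hX hY (hZ.smul hu) x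
  rw [expand hX hY, expand hY hX, hbr, mlieBracket_jacobi hX hY hZ x] at h
  simp only [Pi.add_apply, Pi.smul_apply'] at h
  rw [← sub_eq_zero] at h ⊢
  refine (smul_eq_zero.1 (Eq.trans ?_ (neg_eq_zero.2 h))).resolve_right hx
  module

end SmoothFields

section Connection

variable {E : Type*} [NormedAddCommGroup E] [NormedSpace ℝ E]
  {H : Type*} [TopologicalSpace H] {I : ModelWithCorners ℝ E H}
  {M : Type*} [TopologicalSpace M] [ChartedSpace H M] [IsManifold I ∞ M]
  {X X' Y Y' Z W : Π x : M, TangentSpace I x} {u : M → ℝ}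
  {cov : CovariantDerivative I E (fun x : M ↦ TangentSpace I x)}

theorem IsSmoothField.covDeriv (hcov : cov.ContMDiffCovariantDerivative ∞)
    (hX : IsSmoothField X) (hY : IsSmoothField Y) : IsSmoothField (covDeriv cov X Y) :=
  ContMDiff.clm_bundle_apply (F₁ := E) (F₂ := E)
    (contMDiffOn_univ.1 (hcov.contMDiff.contMDiff (ContMDiff.contMDiffOn hY))) hX

theorem covDeriv_add_left (x : M) :
    covDeriv cov (X + X') Y x = covDeriv cov X Y x + covDeriv cov X' Y x := by
  simp [covDeriv]

theorem covDeriv_neg_left (x : M) : covDeriv cov (-X) Y x = - covDeriv cov X Y x := by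
  simp [covDeriv]

theorem covDeriv_smul_left (x : M) : covDeriv cov (u • X) Y x = u x • covDeriv cov X Y x := by
  simp [covDeriv]

theorem covDeriv_add (hY : IsSmoothField Y) (hZ : IsSmoothField Z) (x : M) :
    covDeriv cov X (Y + Z) x = covDeriv cov X Y x + covDeriv cov X Z x := by
  simp [covDeriv, cov.isCovariantDerivativeOn.add (hY.mdifferentiableAt x) (hZ.mdifferentiableAt x)
    (s := Set.univ)]

theorem covDeriv_smul (hu : CMDiff ∞ u) (hY : IsSmoothField Y) (x : M) :
    covDeriv cov X (u • Y) x = u x • covDeriv cov X Y x + mvfderiv I u x (X x) • Y x := by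
  simp [covDeriv, cov.isCovariantDerivativeOn.leibniz (hY.mdifferentiableAt x)
    (hu.mdifferentiableAt (x := x) (by simp)) (s := Set.univ)]

theorem covDeriv_neg (hY : IsSmoothField Y) (x : M) :
    covDeriv cov X (-Y) x = - covDeriv cov X Y x := by
  have h := covDeriv_smul (cov := cov) (X := X) (u := fun _ ↦ -1) contMDiff_const hY x
  have e : (fun _ : M ↦ (-1 : ℝ)) • Y = -Y := by ext; simp
  simpa [e, mvfderiv_const] using h

theorem covDeriv_sub (hY : IsSmoothField Y) (hZ : IsSmoothField Z) (x : M) :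
    covDeriv cov X (Y - Z) x = covDeriv cov X Y x - covDeriv cov X Z x := by
  have h := covDeriv_add (cov := cov) (X := X) (hY.sub hZ) hZ x
  rw [sub_add_cancel] at h
  rw [h, add_sub_cancel_right]

end Connection

section Curvature

variable {E : Type*} [NormedAddCommGroup E] [NormedSpace ℝ E]
  {H : Type*} [TopologicalSpace H] {I : ModelWithCorners ℝ E H}
  {M : Type*} [TopologicalSpace M] [ChartedSpace H M] [IsManifold I ∞ M]
  {X X' Y Y' Z W : Π x : M, TangentSpace I x} {u : M → ℝ}
  {cov : CovariantDerivative I E (fun x : M ↦ TangentSpace I x)}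
  {A : Π x : M, TangentSpace I x →L[ℝ] TangentSpace I x}

theorem curvature_swap (X Y Z : Π x : M, TangentSpace I x) (x : M) :
    curvature cov X Y Z x = - curvature cov Y X Z x := by
  simp only [curvature]
  rw [mlieBracket_swap, covDeriv_neg_left]
  abel

/-- The curvature is tensorial in its first argument. -/
theorem curvature_tensorialAt [CompleteSpace E] (hcov : cov.ContMDiffCovariantDerivative ∞)
    (hZ : IsSmoothField Z) (x : M) :
    TensorialAt I E (fun X ↦ curvature cov X Y Z x) x := by
  have hd : ∀ {V : Π x : M, TangentSpace I x}, MDiffAt (T% V) x →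
      MDiffAt (T% (covDeriv cov V Z)) x :=
    fun hV ↦ MDifferentiableAt.clm_bundle_apply (F₁ := E) (F₂ := E)
      ((contMDiffOn_univ.1 (hcov.contMDiff.contMDiff (ContMDiff.contMDiffOn hZ))).mdifferentiableAt
        (by simp)) hV
  constructor
  · intro u V hu hV
    have e : covDeriv cov (u • V) Z = u • covDeriv cov V Z := funext fun y ↦ covDeriv_smul_left y
    have h := cov.isCovariantDerivativeOnUniv.leibniz (hd hV) hu
    simp only [curvature]
    rw [e]
    simp only [covDeriv] at h ⊢
    rw [h, mlieBracket_smul_left hu hV]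
    simp only [Pi.smul_apply', map_add, map_smul, neg_smul, map_neg, add_apply, smul_apply,
      ContinuousLinearMap.smulRight_apply]
    module
  · intro V V' hV hV'
    have e : covDeriv cov (V + V') Z = covDeriv cov V Z + covDeriv cov V' Z :=
      funext fun y ↦ covDeriv_add_left y
    have h := cov.isCovariantDerivativeOnUniv.add (hd hV) (hd hV')
    simp only [curvature]
    rw [e]
    simp only [covDeriv] at h ⊢
    rw [h, mlieBracket_add_left hV hV']
    simp only [Pi.add_apply, map_add, add_apply]
    abel

/-- The second covariant derivative `(∇²_{W, X} A) Y` of a (1,1)-tensor field `A`. -/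
noncomputable def secondCovDerivEndo (cov : CovariantDerivative I E (fun x : M ↦ TangentSpace I x))
    (A : Π x : M, TangentSpace I x →L[ℝ] TangentSpace I x)
    (W X Y : Π x : M, TangentSpace I x) : Π x : M, TangentSpace I x :=
  fun x ↦ covDeriv cov W (covDerivEndo cov A X Y) x
    - covDerivEndo cov A (covDeriv cov W X) Y x - covDerivEndo cov A X (covDeriv cov W Y) x

theorem IsSmoothField.covDerivEndo (hcov : cov.ContMDiffCovariantDerivative ∞)
    (hA : IsSmoothEndo A) (hX : IsSmoothField X) (hY : IsSmoothField Y) :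
    IsSmoothField (covDerivEndo cov A X Y) :=
  (hX.covDeriv hcov (hY.endo_apply hA)).sub ((hX.covDeriv hcov hY).endo_apply hA)

theorem secondCovDerivEndo_add_swap (hcov : cov.ContMDiffCovariantDerivative ∞)
    (hA : IsSmoothEndo A)
    (h : ∀ X Y : Π x : M, TangentSpace I x, IsSmoothField X → IsSmoothField Y →
      ∀ x : M, covDerivEndo cov A X Y x + covDerivEndo cov A Y X x = 0)
    (hW : IsSmoothField W) (hX : IsSmoothField X) (hY : IsSmoothField Y) (x : M) :
    secondCovDerivEndo cov A W X Y x + secondCovDerivEndo cov A W Y X x = 0 := by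
  have e : covDerivEndo cov A X Y = - covDerivEndo cov A Y X :=
    funext fun y ↦ eq_neg_of_add_eq_zero_left (h X Y hX hY y)
  have h1 := h _ _ (hW.covDeriv hcov hX) hY x
  have h2 := h _ _ hX (hW.covDeriv hcov hY) x
  simp only [secondCovDerivEndo]
  rw [e, covDeriv_neg (hY.covDerivEndo hcov hA hX), eq_neg_of_add_eq_zero_left h1,
    eq_neg_of_add_eq_zero_left h2]
  abel

variable [RiemannianBundle (fun x : M ↦ TangentSpace I x)]

/-- The Ricci identity for (1,1)-tensor fields. -/
theorem secondCovDerivEndo_sub_swap (hcov : IsLeviCivita cov) (hA : IsSmoothEndo A)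
    (hW : IsSmoothField W) (hX : IsSmoothField X) (hY : IsSmoothField Y) (x : M) :
    secondCovDerivEndo cov A W X Y x - secondCovDerivEndo cov A X W Y x =
      curvature cov W X (fun y ↦ A y (Y y)) x - A x (curvature cov W X Y x) := by
  have hs := hcov.smooth
  have e : ∀ V, covDerivEndo cov A V Y =
      covDeriv cov V (fun y ↦ A y (Y y)) - fun y ↦ A y (covDeriv cov V Y y) := fun V ↦ rfl
  have t : ∀ V, covDeriv cov (mlieBracket I W X) V x =
      covDeriv cov (covDeriv cov W X) V x - covDeriv cov (covDeriv cov X W) V x := fun V ↦ by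
    rw [covDeriv, ← hcov.torsion_free W X hW hX, map_sub]; rfl
  simp only [secondCovDerivEndo, curvature, t]
  rw [e X, covDeriv_sub (hX.covDeriv hs (hY.endo_apply hA)) ((hX.covDeriv hs hY).endo_apply hA),
    e W, covDeriv_sub (hW.covDeriv hs (hY.endo_apply hA)) ((hW.covDeriv hs hY).endo_apply hA)]
  simp only [covDerivEndo, map_sub]
  abel

theorem curvature_bianchi [CompleteSpace E] (hcov : IsLeviCivita cov)
    (hX : IsSmoothField X) (hY : IsSmoothField Y) (hZ : IsSmoothField Z) (x : M) :
    curvature cov X Y Z x + curvature cov Y Z X x + curvature cov Z X Y x = 0 := by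
  have hs := hcov.smooth
  have t : ∀ {X Y Z : Π x : M, TangentSpace I x}, IsSmoothField X → IsSmoothField Y →
      IsSmoothField Z → covDeriv cov X (covDeriv cov Y Z) x - covDeriv cov X (covDeriv cov Z Y) x =
        mlieBracket I X (mlieBracket I Y Z) x + covDeriv cov (mlieBracket I Y Z) X x := by
    intro X Y Z hX hY hZ
    have e : covDeriv cov Y Z - covDeriv cov Z Y = mlieBracket I Y Z :=
      funext fun y ↦ hcov.torsion_free Y Z hY hZ y
    rw [← covDeriv_sub (hY.covDeriv hs hZ) (hZ.covDeriv hs hY), e,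
      ← hcov.torsion_free _ _ hX (hY.mlieBracket hZ), sub_add_cancel]
  have hJ := mlieBracket_jacobi hX hY hZ x
  have h1 := t hX hY hZ
  have h2 := t hY hX hZ
  have h3 := t hZ hX hY
  have s : mlieBracket I (mlieBracket I X Y) Z x = - mlieBracket I Z (mlieBracket I X Y) x := by
    rw [mlieBracket_swap]; rfl
  simp only [curvature]
  rw [mlieBracket_swap (V := Z) (W := X), covDeriv_neg_left]
  rw [s] at hJ
  have h := congrArg₂ (· + ·) (congrArg₂ (· + ·) (congrArg₂ (· - ·) h1 h2) h3) hJ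
  rw [← sub_eq_zero] at h
  exact Eq.trans (by abel) h

theorem IsSmoothField.contMDiff_inner
    [IsContMDiffRiemannianBundle I ∞ E (fun x : M ↦ TangentSpace I x)]
    (hX : IsSmoothField X) (hY : IsSmoothField Y) :
    CMDiff ∞ (fun x ↦ (inner ℝ (X x) (Y x) : ℝ)) :=
  ContMDiff.inner_bundle hX hY

theorem inner_secondCovDerivEndo
    [IsContMDiffRiemannianBundle I ∞ E (fun x : M ↦ TangentSpace I x)]
    (hcov : IsLeviCivita cov) (hA : IsSmoothEndo A)
    (hskew : ∀ (x : M) (v w : TangentSpace I x), inner ℝ (A x v) w = - inner ℝ v (A x w))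
    (hW : IsSmoothField W) (hX : IsSmoothField X) (hY : IsSmoothField Y) (hZ : IsSmoothField Z)
    (x : M) :
    inner ℝ (secondCovDerivEndo cov A W X Y x) (Z x) =
      - inner ℝ (Y x) (secondCovDerivEndo cov A W X Z x) := by
  have hs := hcov.smooth
  have first : ∀ {X Y Z : Π x : M, TangentSpace I x}, IsSmoothField X → IsSmoothField Y →
      IsSmoothField Z → ∀ y, inner ℝ (covDerivEndo cov A X Y y) (Z y) =
        - inner ℝ (Y y) (covDerivEndo cov A X Z y) := by
    intro X Y Z hX hY hZ y
    have h1 := hcov.metric X _ _ hX (hY.endo_apply hA) hZ y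
    have h2 := hcov.metric X _ _ hX hY (hZ.endo_apply hA) y
    simp only [hskew, mvfderiv_fun_neg, neg_apply] at h1
    simp only [covDerivEndo, inner_sub_left, inner_sub_right, hskew]
    have h3 := hskew y (Y y) (covDeriv cov X Z y)
    linarith
  have h1 := hcov.metric W _ _ hW (hX.covDerivEndo hs hA hY) hZ x
  have h2 := hcov.metric W _ _ hW hY (hX.covDerivEndo hs hA hZ) x
  simp only [first hX hY hZ, mvfderiv_fun_neg, neg_apply] at h1
  have h3 := first (hW.covDeriv hs hX) hY hZ x
  have h4 := first hX (hW.covDeriv hs hY) hZ x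
  have h5 := first hX hY (hW.covDeriv hs hZ) x
  simp only [secondCovDerivEndo, inner_sub_left, inner_sub_right]
  linarith

variable [IsContMDiffRiemannianBundle I ∞ E (fun x : M ↦ TangentSpace I x)]

theorem inner_curvature_swap [CompleteSpace E] (hcov : IsLeviCivita cov)
    (hX : IsSmoothField X) (hY : IsSmoothField Y) (hZ : IsSmoothField Z) (hW : IsSmoothField W)
    (x : M) :
    inner ℝ (curvature cov X Y Z x) (W x) = - inner ℝ (Z x) (curvature cov X Y W x) := by
  by_cases h0 : Z x = 0 ∧ W x = 0
  · simp [h0.1, h0.2]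
  obtain ⟨V, hV, hVx⟩ : ∃ V : Π x : M, TangentSpace I x, IsSmoothField V ∧ V x ≠ 0 := by
    by_cases hz : Z x = 0
    · exact ⟨W, hW, fun hw ↦ h0 ⟨hz, hw⟩⟩
    · exact ⟨Z, hZ, hz⟩
  have hs := hcov.smooth
  have second : ∀ {X Y : Π x : M, TangentSpace I x}, IsSmoothField X → IsSmoothField Y →
      mvfderiv I (fun y ↦ mvfderiv I (fun y ↦ (inner ℝ (Z y) (W y) : ℝ)) y (Y y)) x (X x) =
        inner ℝ (covDeriv cov X (covDeriv cov Y Z) x) (W x)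
          + inner ℝ (covDeriv cov Y Z x) (covDeriv cov X W x)
          + (inner ℝ (covDeriv cov X Z x) (covDeriv cov Y W x)
          + inner ℝ (Z x) (covDeriv cov X (covDeriv cov Y W) x)) := by
    intro X Y hX hY
    simp only [hcov.metric Y Z W hY hZ hW]
    rw [mvfderiv_fun_add
      (((hY.covDeriv hs hZ).contMDiff_inner hW).mdifferentiableAt (by simp))
      ((hZ.contMDiff_inner (hY.covDeriv hs hW)).mdifferentiableAt (by simp)),
      add_apply, hcov.metric X _ _ hX (hY.covDeriv hs hZ) hW,
      hcov.metric X _ _ hX hZ (hY.covDeriv hs hW)]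
  have h := mvfderiv_mlieBracket_apply (hZ.contMDiff_inner hW) hX hY hV hVx
  rw [second hX hY, second hY hX, hcov.metric _ _ _ (hX.mlieBracket hY) hZ hW] at h
  simp only [curvature, inner_sub_left, inner_sub_right]
  linarith

theorem inner_curvature_pair_swap [CompleteSpace E] (hcov : IsLeviCivita cov)
    (hX : IsSmoothField X) (hY : IsSmoothField Y) (hZ : IsSmoothField Z) (hW : IsSmoothField W)
    (x : M) :
    (inner ℝ (curvature cov X Y Z x) (W x) : ℝ) = inner ℝ (curvature cov Z W X x) (Y x) := by
  have b : ∀ {X Y Z W : Π x : M, TangentSpace I x}, IsSmoothField X → IsSmoothField Y →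
      IsSmoothField Z → IsSmoothField W →
      (inner ℝ (curvature cov X Y Z x) (W x) : ℝ) + inner ℝ (curvature cov Y Z X x) (W x)
        + inner ℝ (curvature cov Z X Y x) (W x) = 0 := by
    intro X Y Z W hX hY hZ hW
    rw [← inner_add_left, ← inner_add_left, curvature_bianchi hcov hX hY hZ, inner_zero_left]
  have s : ∀ X Y Z W : Π x : M, TangentSpace I x,
      (inner ℝ (curvature cov X Y Z x) (W x) : ℝ) = - inner ℝ (curvature cov Y X Z x) (W x) := by
    intro X Y Z W
    rw [curvature_swap, inner_neg_left]
  have m : ∀ {X Y Z W : Π x : M, TangentSpace I x}, IsSmoothField X → IsSmoothField Y →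
      IsSmoothField Z → IsSmoothField W →
      (inner ℝ (curvature cov X Y Z x) (W x) : ℝ) = - inner ℝ (curvature cov X Y W x) (Z x) := by
    intro X Y Z W hX hY hZ hW
    rw [inner_curvature_swap hcov hX hY hZ hW, real_inner_comm]
  linarith [b hX hY hZ hW, b hY hZ hW hX, b hZ hW hX hY, b hW hX hY hZ,
    m hX hY hZ hW, m hY hZ hX hW, m hZ hX hY hW, m hY hZ hW hX, m hZ hW hY hX, m hW hY hZ hX,
    m hZ hW hX hY, m hW hX hZ hY, m hX hZ hW hY, m hW hX hY hZ, m hX hY hW hZ, m hY hW hX hZ,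
    s X Y Z W, s Y Z X W, s Z X Y W, s Y Z W X, s Z W Y X, s W Y Z X, s Z W X Y, s W X Z Y,
    s X Z W Y, s W X Y Z, s X Y W Z, s Y W X Z]

end Curvature

section CurvatureCongr

variable {E : Type*} [NormedAddCommGroup E] [NormedSpace ℝ E] [FiniteDimensional ℝ E]
  {H : Type*} [TopologicalSpace H] {I : ModelWithCorners ℝ E H}
  {M : Type*} [TopologicalSpace M] [ChartedSpace H M] [IsManifold I ∞ M]
  {X X' Y Y' Z Z' : Π x : M, TangentSpace I x}
  {cov : CovariantDerivative I E (fun x : M ↦ TangentSpace I x)}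

theorem curvature_congr_left (hcov : cov.ContMDiffCovariantDerivative ∞)
    (hX : IsSmoothField X) (hX' : IsSmoothField X') (hZ : IsSmoothField Z) {x : M}
    (h : X x = X' x) : curvature cov X Y Z x = curvature cov X' Y Z x := by
  have := FiniteDimensional.complete ℝ E
  exact (curvature_tensorialAt hcov hZ x).pointwise (hX.mdifferentiableAt x)
    (hX'.mdifferentiableAt x) h

/-- The curvature at a point depends only on the values of its arguments at that point. -/
theorem curvature_congr [RiemannianBundle (fun x : M ↦ TangentSpace I x)] (hcov : IsLeviCivita cov)
    (hX : IsSmoothField X) (hX' : IsSmoothField X') (hY : IsSmoothField Y) (hY' : IsSmoothField Y')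
    (hZ : IsSmoothField Z) (hZ' : IsSmoothField Z') {x : M}
    (eX : X x = X' x) (eY : Y x = Y' x) (eZ : Z x = Z' x) :
    curvature cov X Y Z x = curvature cov X' Y' Z' x := by
  have := FiniteDimensional.complete ℝ E
  have hs := hcov.smooth
  have right : ∀ {X Y Y' Z : Π x : M, TangentSpace I x}, IsSmoothField Y → IsSmoothField Y' →
      IsSmoothField Z → Y x = Y' x → curvature cov X Y Z x = curvature cov X Y' Z x := by
    intro X Y Y' Z hY hY' hZ e
    rw [curvature_swap, curvature_congr_left hs hY hY' hZ e, ← curvature_swap]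
  have b : ∀ {Z}, IsSmoothField Z → curvature cov X' Y' Z x =
      - curvature cov Y' Z X' x - curvature cov Z X' Y' x := fun hZ ↦ by
    rw [← neg_add', ← add_eq_zero_iff_eq_neg, ← add_assoc, curvature_bianchi hcov hX' hY' hZ]
  rw [curvature_congr_left hs hX hX' hZ eX, right hY hY' hZ eY, b hZ, b hZ',
    curvature_congr_left hs hZ hZ' hY' eZ, right hZ hZ' hX' eZ]

end CurvatureCongr

namespace WeakMetricFStructure

variable {E : Type*} [NormedAddCommGroup E] [NormedSpace ℝ E]
  {H : Type*} [TopologicalSpace H] {I : ModelWithCorners ℝ E H}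
  {M : Type*} [TopologicalSpace M] [ChartedSpace H M] [IsManifold I ∞ M]
  [RiemannianBundle (fun x : M ↦ TangentSpace I x)] {n s : ℕ}

theorem eta_eq_inner (S : WeakMetricFStructure I M n s)
    (hQ : ∀ x, S.Q x = ContinuousLinearMap.id ℝ _) (x : M) (v : TangentSpace I x) (j : Fin s) :
    S.η j x v = inner ℝ v (S.ξ j x) := by
  have h := S.inner_f_f x v (S.ξ j x)
  have hff : S.f x (S.f x (S.ξ j x)) = 0 := by simp [S.f_sq, hQ, S.η_ξ]
  rw [S.f_skew, hff] at h
  simp [hQ, S.η_ξ] at h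
  linarith

theorem f_xi (S : WeakMetricFStructure I M n s)
    (hQ : ∀ x, S.Q x = ContinuousLinearMap.id ℝ _) (x : M) (j : Fin s) :
    S.f x (S.ξ j x) = 0 := by
  have h := S.inner_f_f x (S.ξ j x) (S.ξ j x)
  have h1 : inner ℝ (S.ξ j x) (S.ξ j x) = (1 : ℝ) := by
    rw [real_inner_self_eq_norm_sq, (S.ξ_orthonormal x).1 j, one_pow]
  rw [← inner_self_eq_zero (𝕜 := ℝ), h]
  simp only [hQ, ContinuousLinearMap.id_apply, h1, S.η_ξ]
  simp

theorem f_cube (S : WeakMetricFStructure I M n s)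
    (hQ : ∀ x, S.Q x = ContinuousLinearMap.id ℝ _) (x : M) (v : TangentSpace I x) :
    S.f x (S.f x (S.f x v)) = - S.f x v := by
  simpa [hQ, S.f_xi hQ] using congrArg (S.f x) (S.f_sq x v)

variable [FiniteDimensional ℝ E]
  [IsContMDiffRiemannianBundle I ∞ E (fun x : M ↦ TangentSpace I x)]
  {cov : CovariantDerivative I E (fun x : M ↦ TangentSpace I x)}

/-- The component along `ξ i` of the curvature of the contact distribution, expressed through the
3-form `(X, Y, Z) ↦ g((∇²_{ξ i, X} f) Y, Z)`. -/
theorem two_mul_inner_curvature_f (S : WeakMetricFStructure I M n s) (hcov : IsLeviCivita cov)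
    (hS : S.IsNearlyC cov) (i : Fin s) {W X Y : Π x : M, TangentSpace I x}
    (hW : IsSmoothField W) (hX : IsSmoothField X) (hY : IsSmoothField Y) (x : M) :
    2 * (inner ℝ (curvature cov W X (fun y ↦ S.f y (Y y)) x) (S.ξ i x) : ℝ) =
      2 * inner ℝ (secondCovDerivEndo cov S.f (S.ξ i) W X x) (Y x)
        + inner ℝ (curvature cov (fun y ↦ S.f y (X y)) Y W x) (S.ξ i x)
        - inner ℝ (curvature cov (fun y ↦ S.f y (W y)) Y X x) (S.ξ i x) := by
  have := FiniteDimensional.complete ℝ E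
  have hξ := S.ξ_smooth i
  have hf := S.f_smooth
  have hs := hcov.smooth
  have horizontal : (inner ℝ (curvature cov W X (fun y ↦ S.f y (Y y)) x) (S.ξ i x) : ℝ) =
      inner ℝ (secondCovDerivEndo cov S.f W X Y x) (S.ξ i x)
        - inner ℝ (secondCovDerivEndo cov S.f X W Y x) (S.ξ i x) := by
    rw [← inner_sub_left, secondCovDerivEndo_sub_swap hcov hf hW hX hY, inner_sub_left, S.f_skew,
      S.f_xi hS.2, inner_zero_right, neg_zero, sub_zero]
  have mixed : ∀ {X Y Z : Π x : M, TangentSpace I x}, IsSmoothField X → IsSmoothField Y →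
      IsSmoothField Z →
      (inner ℝ (secondCovDerivEndo cov S.f X Y Z x) (S.ξ i x) : ℝ) =
        inner ℝ (secondCovDerivEndo cov S.f (S.ξ i) X Y x) (Z x)
          + inner ℝ (curvature cov (fun y ↦ S.f y (Y y)) Z X x) (S.ξ i x)
          + inner ℝ (curvature cov Y (fun y ↦ S.f y (Z y)) X x) (S.ξ i x) := by
    intro X Y Z hX hY hZ
    have hc : ∀ {V U : Π x : M, TangentSpace I x}, IsSmoothField V → IsSmoothField U →
        (inner ℝ (curvature cov (S.ξ i) X V x) (U x) : ℝ) =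
          - inner ℝ (curvature cov V U X x) (S.ξ i x) := by
      intro V U hV hU
      rw [inner_curvature_pair_swap hcov hξ hX hV hU, inner_curvature_swap hcov hV hU hξ hX,
        real_inner_comm]
    have h := congrArg (fun v : TangentSpace I x ↦ (inner ℝ v (Z x) : ℝ))
      (secondCovDerivEndo_sub_swap hcov hf hξ hX hY x)
    simp only [inner_sub_left, S.f_skew] at h
    have h1 := hc (hY.endo_apply hf) hZ
    have h2 := hc hY (hZ.endo_apply hf)
    have h3 : (inner ℝ (secondCovDerivEndo cov S.f X (S.ξ i) Y x) (Z x) : ℝ) =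
        inner ℝ (secondCovDerivEndo cov S.f X Y Z x) (S.ξ i x) := by
      rw [eq_neg_of_add_eq_zero_left (secondCovDerivEndo_add_swap hs hf hS.1 hX hξ hY x),
        inner_neg_left, inner_secondCovDerivEndo hcov hf S.f_skew hX hY hξ hZ, neg_neg,
        real_inner_comm]
    linarith
  have hc : (inner ℝ (secondCovDerivEndo cov S.f (S.ξ i) X W x) (Y x) : ℝ) =
      - inner ℝ (secondCovDerivEndo cov S.f (S.ξ i) W X x) (Y x) := by
    rw [eq_neg_of_add_eq_zero_left (secondCovDerivEndo_add_swap hs hf hS.1 hξ hX hW x),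
      inner_neg_left]
  have b := congrArg (fun v : TangentSpace I x ↦ (inner ℝ v (S.ξ i x) : ℝ))
    (curvature_bianchi hcov hW hX (hY.endo_apply hf) x)
  have sw := congrArg (fun v : TangentSpace I x ↦ (inner ℝ v (S.ξ i x) : ℝ))
    (curvature_swap (cov := cov) W (fun y ↦ S.f y (Y y)) X x)
  simp only [inner_add_left, inner_zero_left, inner_neg_left] at b sw
  linarith [mixed hW hX hY, mixed hX hW hY]

theorem inner_curvature_xi_eq_zero (S : WeakMetricFStructure I M n s) (hcov : IsLeviCivita cov)
    (hS : S.IsNearlyC cov) (i : Fin s) {X Y Z : Π x : M, TangentSpace I x}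
    (hX : IsSmoothField X) (hY : IsSmoothField Y) (hZ : IsSmoothField Z)
    (fX : ∀ x, S.f x (S.f x (X x)) = - X x) (fY : ∀ x, S.f x (S.f x (Y x)) = - Y x)
    (fZ : ∀ x, S.f x (S.f x (Z x)) = - Z x) (x : M) :
    inner ℝ (curvature cov X Y Z x) (S.ξ i x) = (0 : ℝ) := by
  have := FiniteDimensional.complete ℝ E
  have hξ := S.ξ_smooth i
  have hf := S.f_smooth
  let V := {X : Π x : M, TangentSpace I x //
    IsSmoothField X ∧ ∀ x, S.f x (S.f x (X x)) = - X x}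
  let J : V → V := fun X ↦ ⟨fun y ↦ S.f y (X.1 y), X.2.1.endo_apply hf, fun y ↦ by
    rw [X.2.2, map_neg]⟩
  refine eq_zero_of_bianchi_of_complexStructure J
    (fun X Y Z ↦ inner ℝ (curvature cov X.1 Y.1 Z.1 x) (S.ξ i x))
    (fun X Y Z ↦ inner ℝ (secondCovDerivEndo cov S.f (S.ξ i) X.1 Y.1 x) (Z.1 x))
    (fun X Y Z ↦ ?_) (fun X Y Z ↦ ?_) (fun X Y Z ↦ ?_) (fun X Y Z ↦ ?_) (fun X Y Z ↦ ?_)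
    (fun W X Y ↦ S.two_mul_inner_curvature_f hcov hS i W.2.1 X.2.1 Y.2.1 x)
    ⟨X, hX, fX⟩ ⟨Y, hY, fY⟩ ⟨Z, hZ, fZ⟩
  · rw [curvature_swap, inner_neg_left]
  · rw [← inner_add_left, ← inner_add_left, curvature_bianchi hcov X.2.1 Y.2.1 Z.2.1,
      inner_zero_left]
  · have e : (J (J X)).1 = (fun _ : M ↦ (-1 : ℝ)) • X.1 := funext fun y ↦ by
      simpa using! X.2.2 y
    have h := (curvature_tensorialAt (Y := Y.1) hcov.smooth Z.2.1 x).smul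
      (f := fun _ : M ↦ (-1 : ℝ)) mdifferentiableAt_const (X.2.1.mdifferentiableAt x)
    simp only [e, h, neg_smul, one_smul, inner_neg_left]
  · rw [eq_neg_of_add_eq_zero_left
      (secondCovDerivEndo_add_swap hcov.smooth hf hS.1 hξ X.2.1 Y.2.1 x), inner_neg_left]
  · rw [inner_secondCovDerivEndo hcov hf S.f_skew hξ X.2.1 Y.2.1 Z.2.1, real_inner_comm]

end WeakMetricFStructure

end FManifold

theorem mainTheorem8 {E : Type*} [NormedAddCommGroup E] [NormedSpace ℝ E] [FiniteDimensional ℝ E]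
    {M : Type*} [TopologicalSpace M] [T2Space M] [SecondCountableTopology M]
    [ChartedSpace E M] [IsManifold 𝓘(ℝ, E) ∞ M]
    [RiemannianBundle (fun x : M ↦ TangentSpace 𝓘(ℝ, E) x)]
    [IsContMDiffRiemannianBundle 𝓘(ℝ, E) ∞ E (fun x : M ↦ TangentSpace 𝓘(ℝ, E) x)]
    (cov : CovariantDerivative 𝓘(ℝ, E) E (fun x : M ↦ TangentSpace 𝓘(ℝ, E) x))
    (hcov : FManifold.IsLeviCivita cov)
    {n s : ℕ} (S : FManifold.WeakMetricFStructure 𝓘(ℝ, E) M n s) (hS : S.IsNearlyC cov)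
    (X Y Z : Π x : M, TangentSpace 𝓘(ℝ, E) x)
    (hX : FManifold.IsSmoothField X) (hY : FManifold.IsSmoothField Y)
    (hZ : FManifold.IsSmoothField Z) (p : M)
    (hXp : X p ∈ S.contactDistribution p) (hYp : Y p ∈ S.contactDistribution p)
    (hZp : Z p ∈ S.contactDistribution p) :
    FManifold.curvature cov X Y Z p ∈ S.contactDistribution p := by
  simp only [FManifold.WeakMetricFStructure.contactDistribution, Submodule.mem_iInf,
    LinearMap.mem_ker, ContinuousLinearMap.coe_coe] at hXp hYp hZp ⊢
  intro i
  have sq : ∀ {V : Π x : M, TangentSpace 𝓘(ℝ, E) x}, FManifold.IsSmoothField V →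
      FManifold.IsSmoothField
        (fun x ↦ S.f x (S.f x (S.f x (S.f x (V x))))) := fun hV ↦
    (((hV.endo_apply S.f_smooth).endo_apply S.f_smooth).endo_apply S.f_smooth).endo_apply S.f_smooth
  have sq_sq : ∀ (V : Π x : M, TangentSpace 𝓘(ℝ, E) x) (x : M),
      S.f x (S.f x (S.f x (S.f x (S.f x (S.f x (V x)))))) =
        - S.f x (S.f x (S.f x (S.f x (V x)))) := fun V x ↦ S.f_cube hS.2 x _
  have val : ∀ {V : Π x : M, TangentSpace 𝓘(ℝ, E) x}, (∀ i, S.η i p (V p) = 0) →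
      V p = S.f p (S.f p (S.f p (S.f p (V p)))) := fun {V} h ↦ by
    rw [S.f_cube hS.2, S.f_sq]
    simp [h, hS.2]
  rw [S.eta_eq_inner hS.2, FManifold.curvature_congr hcov hX (sq hX) hY (sq hY) hZ (sq hZ)
    (val hXp) (val hYp) (val hZp)]
  exact S.inner_curvature_xi_eq_zero hcov hS i (sq hX) (sq hY) (sq hZ) (sq_sq X) (sq_sq Y)
    (sq_sq Z) p
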